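/- Let $X$ be a complex Banach space and let $(T(t))_{t\ge 0}$ be a differentiable $C_0$ semigroup on $X$, i.e. a $C_0$ semigroup of bounded operators such that $t\mapsto T(t)x$ is differentiable on $(0,\infty)$ for every $x\in X$. Let $A$ be its infinitesimal generator, $Ax=\lim_{t\to0^+}\frac{T(t)x-x}{t}$ with domain $D(A)$ the set of all $x\in X$ for which this limit exists. A closed linear operator $S$ on $X$ is called *upper semi-Fredholm* if $\dim N(S)<\infty$ and $R(S)$ is closed, *lower semi-Fredholm* if $\operatorname{codim} R(S)<\infty$, and *Fredholm* if it is both. It is called *upper semi-Browder* if it is upper semi-Fredholm and has finite ascent $\inf\{n\in\mathbb N: N(S^n)=N(S^{n+1})\}$, *lower semi-Browder* if it is lower semi-Fredholm and has finite descent $\inf\{n\in\mathbb N: R(S^n)=R(S^{n+1})\}$ (with $\inf\emptyset=\infty$), and *Browder* if it is both upper and lower semi-Browder. Let $\sigma_{uf}(S)$, $\sigma_{lf}(S)$, $\sigma_{e}(S)$, $\sigma_{ub}(S)$, $\sigma_{lb}(S)$, $\sigma_{b}(S)$ be the sets of all $\lambda\in\mathbb C$ such that $S-\lambda I$ is not,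 respectively, upper semi-Fredholm, lower semi-Fredholm, Fredholm, upper semi-Browder, lower semi-Browder, Browder. Then for every $t>0$ and every $\sigma_*\in\{\sigma_{uf},\sigma_{lf},\sigma_{e},\sigma_{ub},\sigma_{lb},\sigma_{b}\}$, $$\sigma_*(T(t))\setminus\{0\}=\{e^{\lambda t}:\lambda\in\sigma_*(A)\}.$$ -/

import Mathlib

open Filter Topology

namespace SpectralMapping

section

variable {X : Type*} [NormedAddCommGroup X] [NormedSpace ℂ X]

/-- A family `T t`, `t ≥ 0`, of bounded linear operators is a `C₀` semigroup. The values `T t` for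
`t < 0` play no role. -/
structure IsC0Semigroup (T : ℝ → X →L[ℂ] X) : Prop where
  zero : T 0 = ContinuousLinearMap.id ℂ X
  add : ∀ t s : ℝ, 0 ≤ t → 0 ≤ s → T (t + s) = (T t).comp (T s)
  tendsto : ∀ x : X, Tendsto (fun t : ℝ => T t x) (𝓝[>] 0) (𝓝 x)

/-- The semigroup is differentiable: every orbit `t ↦ T t x` is differentiable on `(0, ∞)`. -/
def IsDifferentiableSemigroup (T : ℝ → X →L[ℂ] X) : Prop :=
  ∀ x : X, ∀ t : ℝ, 0 < t → DifferentiableAt ℝ (fun s : ℝ => T s x) t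

/-- `y` is the right derivative at `0` of the orbit of `x`, that is, `y = A x`. -/
def IsGenValue (T : ℝ → X →L[ℂ] X) (x y : X) : Prop :=
  Tendsto (fun t : ℝ => ((t : ℂ)⁻¹) • (T t x - x)) (𝓝[>] 0) (𝓝 y)

theorem IsGenValue.unique {T : ℝ → X →L[ℂ] X} {x y z : X} (hy : IsGenValue T x y)
    (hz : IsGenValue T x z) : y = z :=
  tendsto_nhds_unique hy hz

theorem IsGenValue.add {T : ℝ → X →L[ℂ] X} {x y x' y' : X} (h : IsGenValue T x y)
    (h' : IsGenValue T x' y') : IsGenValue T (x + x') (y + y') := by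
  refine (Tendsto.add h h').congr fun t => ?_
  rw [map_add, ← smul_add]
  congr 1
  abel

theorem IsGenValue.smul {T : ℝ → X →L[ℂ] X} {x y : X} (c : ℂ) (h : IsGenValue T x y) :
    IsGenValue T (c • x) (c • y) := by
  refine (Tendsto.const_smul h c).congr fun t => ?_
  rw [map_smul, ← smul_sub, smul_comm]

theorem IsGenValue.zero (T : ℝ → X →L[ℂ] X) : IsGenValue T 0 0 := by
  simp [IsGenValue]

/-- The infinitesimal generator `A` of `T`: its domain `D(A)` consists of all `x` for which
`lim_{t → 0+} (T t x - x) / t` exists, and `A x` is that limit. -/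
noncomputable def generator (T : ℝ → X →L[ℂ] X) : X →ₗ.[ℂ] X where
  domain :=
    { carrier := {x | ∃ y, IsGenValue T x y}
      add_mem' := fun ⟨_, h⟩ ⟨_, h'⟩ => ⟨_, h.add h'⟩
      zero_mem' := ⟨0, IsGenValue.zero T⟩
      smul_mem' := fun c _ ⟨_, h⟩ => ⟨_, h.smul c⟩ }
  toFun :=
    { toFun := fun x => x.2.choose
      map_add' := fun x y =>
        (x + y).2.choose_spec.unique (x.2.choose_spec.add y.2.choose_spec)
      map_smul' := fun c x =>
        (c • x).2.choose_spec.unique (x.2.choose_spec.smul c) }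

/-- A bounded operator, seen as an (everywhere defined) unbounded operator. -/
def ofBounded (S : X →L[ℂ] X) : X →ₗ.[ℂ] X := (S : X →ₗ[ℂ] X).toPMap ⊤

end

section

variable {X : Type*} [AddCommGroup X] [Module ℂ X]

/-- `A - z I`, with domain `D(A)`. -/
def shift (A : X →ₗ.[ℂ] X) (z : ℂ) : X →ₗ.[ℂ] X :=
  (-(z • (LinearMap.id : X →ₗ[ℂ] X))) +ᵥ A

/-- The null space `N(A) = {x ∈ D(A) | A x = 0}`. -/
def nullSpace (A : X →ₗ.[ℂ] X) : Submodule ℂ X :=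
  (LinearMap.ker A.toFun).map A.domain.subtype

/-- The range `R(A)`. -/
def rangeSpace (A : X →ₗ.[ℂ] X) : Submodule ℂ X :=
  LinearMap.range A.toFun

/-- The composition `A B`, with domain `{x ∈ D(B) | B x ∈ D(A)}`. -/
def mulOp (A B : X →ₗ.[ℂ] X) : X →ₗ.[ℂ] X where
  domain :=
    { carrier := {x | ∃ h : x ∈ B.domain, B ⟨x, h⟩ ∈ A.domain}
      add_mem' := fun {x y} ⟨h, hB⟩ ⟨h', hB'⟩ => ⟨B.domain.add_mem h h', by
        have e : B ⟨x + y, B.domain.add_mem h h'⟩ = B ⟨x, h⟩ + B ⟨y, h'⟩ :=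
          B.map_add ⟨x, h⟩ ⟨y, h'⟩
        rw [e]
        exact A.domain.add_mem hB hB'⟩
      zero_mem' := ⟨B.domain.zero_mem, by
        have e : B ⟨0, B.domain.zero_mem⟩ = 0 := B.map_zero
        rw [e]
        exact A.domain.zero_mem⟩
      smul_mem' := fun c x ⟨h, hB⟩ => ⟨B.domain.smul_mem c h, by
        have e : B ⟨c • x, B.domain.smul_mem c h⟩ = c • B ⟨x, h⟩ := B.map_smul c ⟨x, h⟩
        rw [e]
        exact A.domain.smul_mem c hB⟩ }
  toFun :=
    { toFun := fun x => A ⟨B ⟨x, x.2.choose⟩, x.2.choose_spec⟩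
      map_add' := fun x y => by
        rw [← A.map_add]
        congr 1
        exact Subtype.ext (B.map_add ⟨x, x.2.choose⟩ ⟨y, y.2.choose⟩)
      map_smul' := fun c x => by
        rw [RingHom.id_apply, ← A.map_smul]
        congr 1
        exact Subtype.ext (B.map_smul c ⟨x, x.2.choose⟩) }

/-- The powers of an operator: `A ^ 0 = I` (on the whole space) and `A ^ (n + 1) = A A ^ n`, with
`D(A ^ (n + 1)) = {x ∈ D(A ^ n) | A ^ n x ∈ D(A)}`. -/
def powOp (A : X →ₗ.[ℂ] X) : ℕ → (X →ₗ.[ℂ] X)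
  | 0 => (LinearMap.id : X →ₗ[ℂ] X).toPMap ⊤
  | n + 1 => mulOp A (powOp A n)

/-- The ascent `inf {n | N(A ^ n) = N(A ^ (n + 1))}`, which is `⊤` if there is no such `n`. -/
noncomputable def ascent (A : X →ₗ.[ℂ] X) : ℕ∞ :=
  ⨅ (n : ℕ) (_ : nullSpace (powOp A n) = nullSpace (powOp A (n + 1))), (n : ℕ∞)

/-- The descent `inf {n | R(A ^ n) = R(A ^ (n + 1))}`, which is `⊤` if there is no such `n`. -/
noncomputable def descent (A : X →ₗ.[ℂ] X) : ℕ∞ :=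
  ⨅ (n : ℕ) (_ : rangeSpace (powOp A n) = rangeSpace (powOp A (n + 1))), (n : ℕ∞)

end

section

variable {X : Type*} [NormedAddCommGroup X] [NormedSpace ℂ X]

/-- A closed operator is upper semi-Fredholm if its null space has finite dimension and its range
is closed. -/
structure IsUpperSemiFredholm (A : X →ₗ.[ℂ] X) : Prop where
  closed : A.IsClosed
  finite_nullSpace : FiniteDimensional ℂ (nullSpace A)
  closed_range : IsClosed (rangeSpace A : Set X)

/-- A closed operator is lower semi-Fredholm if its range has finite codimension. -/
structure IsLowerSemiFredholm (A : X →ₗ.[ℂ] X) : Prop where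
  closed : A.IsClosed
  finite_codim : FiniteDimensional ℂ (X ⧸ rangeSpace A)

def IsFredholmOp (A : X →ₗ.[ℂ] X) : Prop :=
  IsUpperSemiFredholm A ∧ IsLowerSemiFredholm A

def IsUpperSemiBrowder (A : X →ₗ.[ℂ] X) : Prop :=
  IsUpperSemiFredholm A ∧ ascent A < ⊤

def IsLowerSemiBrowder (A : X →ₗ.[ℂ] X) : Prop :=
  IsLowerSemiFredholm A ∧ descent A < ⊤

def IsBrowder (A : X →ₗ.[ℂ] X) : Prop :=
  IsUpperSemiBrowder A ∧ IsLowerSemiBrowder A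

/-- The upper semi-Fredholm spectrum. -/
def specUF (A : X →ₗ.[ℂ] X) : Set ℂ := {z | ¬ IsUpperSemiFredholm (shift A z)}

/-- The lower semi-Fredholm spectrum. -/
def specLF (A : X →ₗ.[ℂ] X) : Set ℂ := {z | ¬ IsLowerSemiFredholm (shift A z)}

/-- The Fredholm (essential) spectrum. -/
def specF (A : X →ₗ.[ℂ] X) : Set ℂ := {z | ¬ IsFredholmOp (shift A z)}

/-- The upper semi-Browder spectrum. -/
def specUB (A : X →ₗ.[ℂ] X) : Set ℂ := {z | ¬ IsUpperSemiBrowder (shift A z)}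

/-- The lower semi-Browder spectrum. -/
def specLB (A : X →ₗ.[ℂ] X) : Set ℂ := {z | ¬ IsLowerSemiBrowder (shift A z)}

/-- The Browder spectrum. -/
def specB (A : X →ₗ.[ℂ] X) : Set ℂ := {z | ¬ IsBrowder (shift A z)}

end

end SpectralMapping

namespace SpectralMapping

/-! ### Properties that are multiplicative on coprime pairs -/

/-! The unbounded problem is moved into a commutative Banach algebra of bounded operators, the
bicommutant of the semigroup. Besides `T t` it contains a resolvent `R = (ν - A)⁻¹`, the operators
`B z = ∫ s in 0..t, exp (z (t - s)) T s`, and `D = A (T t)`, which is bounded because the semigroup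
is differentiable. Put `b z = 1 + (z - ν) R = (z - A) R`. The graph of `A - z` is the set of pairs
`(-R w, b z w)`, and `-R`, `b z` are coprime. Hence null space and range of every power of `A - z`
are those of the same power of `b z` (`HasParamGraph.powOp`).

For `μ ≠ 0` one has `μ - T t = b z₁ ⋯ b zₖ H` with `H` invertible, the `zᵢ` being the solutions of
`exp (t z) = μ` in some disc (`exists_isUnit`). For a solution outside the disc, `b z` is
invertible: a character killing `b z` sends `D` to `z μ`, which is bounded by `‖D‖ ‖1‖`. That `H` is
invertible is also tested on characters, and rests on the zeros of `exp (t z) - μ` being simple.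

Distinct factors `b z` are coprime, and by Bézout each condition in the theorem holds for a coprime
product exactly if it holds for both factors. So `T t - μ` satisfies the condition iff `A - z` does
for every `z` with `exp (t z) = μ` (`iff_forall_exp_eq`). -/

/-- A property of the elements of a commutative ring that holds for `1`, and for a product of two
coprime elements exactly if it holds for both. -/
structure CoprimeMultiplicative {𝒜 : Type*} [CommRing 𝒜] (P : 𝒜 → Prop) : Prop where
  one : P 1
  mul_iff : ∀ {a b : 𝒜}, IsCoprime a b → (P (a * b) ↔ P a ∧ P b)

namespace CoprimeMultiplicative

variable {𝒜 : Type*} [CommRing 𝒜] {P Q : 𝒜 → Prop}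

theorem and (hP : CoprimeMultiplicative P) (hQ : CoprimeMultiplicative Q) :
    CoprimeMultiplicative fun a => P a ∧ Q a where
  one := ⟨hP.one, hQ.one⟩
  mul_iff h := by rw [hP.mul_iff h, hQ.mul_iff h]; tauto

theorem of_isUnit (hP : CoprimeMultiplicative P) {a : 𝒜} (ha : IsUnit a) : P a := by
  obtain ⟨b, hb⟩ := ha.exists_right_inv
  have h : IsCoprime a b := ⟨b, 0, by rw [zero_mul, add_zero, mul_comm, hb]⟩
  exact ((hP.mul_iff h).1 (hb ▸ hP.one)).1

theorem mul_isUnit_iff (hP : CoprimeMultiplicative P) {a b : 𝒜} (hb : IsUnit b) :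
    P (a * b) ↔ P a := by
  obtain ⟨c, hc⟩ := hb.exists_right_inv
  have h : IsCoprime a b := ⟨0, c, by rw [zero_mul, zero_add, mul_comm, hc]⟩
  rw [hP.mul_iff h, and_iff_left (hP.of_isUnit hb)]

theorem prod_iff (hP : CoprimeMultiplicative P) {ι : Type*} {s : Finset ι} {b : ι → 𝒜}
    (hb : (s : Set ι).Pairwise fun i j => IsCoprime (b i) (b j)) :
    P (∏ i ∈ s, b i) ↔ ∀ i ∈ s, P (b i) := by
  classical
  induction s using Finset.induction_on with
  | empty => simp [hP.one]
  | insert i s hi ih =>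
    have h : IsCoprime (b i) (∏ j ∈ s, b j) := IsCoprime.prod_right fun j hj =>
      hb (by simp) (by simp [hj]) (by rintro rfl; exact hi hj)
    rw [Finset.prod_insert hi, hP.mul_iff h, ih (hb.mono (by simp))]
    simp

end CoprimeMultiplicative

/-! ### A commutative ring acting by bounded operators -/

section Action

variable {X : Type*} [NormedAddCommGroup X] [NormedSpace ℂ X] {𝒜 : Type*} [CommRing 𝒜]
  (ρ : 𝒜 →+* (X →L[ℂ] X))

theorem action_mul (a b : 𝒜) (x : X) : ρ (a * b) x = ρ a (ρ b x) := by
  rw [map_mul]; rfl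

theorem action_comm (a b : 𝒜) (x : X) : ρ a (ρ b x) = ρ b (ρ a x) := by
  rw [← action_mul, mul_comm, action_mul]

theorem action_add (a b : 𝒜) (x : X) : ρ (a + b) x = ρ a x + ρ b x := by
  rw [map_add]; rfl

theorem action_one (x : X) : ρ 1 x = x := by
  rw [map_one]; rfl

/-- The null space of `ρ a`. -/
def actionKer (a : 𝒜) : Submodule ℂ X := LinearMap.ker (ρ a : X →ₗ[ℂ] X)

/-- The range of `ρ a`. -/
def actionRange (a : 𝒜) : Submodule ℂ X := LinearMap.range (ρ a : X →ₗ[ℂ] X)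

theorem mem_actionKer {a : 𝒜} {x : X} : x ∈ actionKer ρ a ↔ ρ a x = 0 := Iff.rfl

theorem mem_actionRange {a : 𝒜} {x : X} : x ∈ actionRange ρ a ↔ ∃ y, ρ a y = x := Iff.rfl

theorem actionKer_le_mul (a b : 𝒜) : actionKer ρ b ≤ actionKer ρ (a * b) := fun x hx => by
  rw [mem_actionKer] at hx ⊢
  rw [action_mul, hx, map_zero]

theorem actionRange_mul_le (a b : 𝒜) : actionRange ρ (a * b) ≤ actionRange ρ a := by
  rintro _ ⟨y, rfl⟩
  exact ⟨ρ b y, (action_mul ρ a b y).symm⟩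

/-- Bézout's identity applied to a vector; the later facts about coprime pairs of operators rest on
it. -/
theorem exists_decomposition {a b : 𝒜} (h : IsCoprime a b) :
    ∃ u v : 𝒜, ∀ x, x = ρ a (ρ u x) + ρ b (ρ v x) := by
  obtain ⟨u, v, huv⟩ := h
  refine ⟨u, v, fun x => ?_⟩
  rw [← action_mul, ← action_mul, ← action_add, mul_comm a, mul_comm b, huv, action_one]

theorem actionKer_mul {a b : 𝒜} (h : IsCoprime a b) :
    actionKer ρ (a * b) = actionKer ρ a ⊔ actionKer ρ b := by
  apply le_antisymm
  · intro x hx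
    obtain ⟨u, v, huv⟩ := exists_decomposition ρ h
    rw [mem_actionKer] at hx
    rw [huv x, add_comm]
    refine Submodule.add_mem_sup ?_ ?_ <;> rw [mem_actionKer]
    · rw [← action_mul, action_comm, hx, map_zero]
    · rw [← action_mul, mul_comm, action_comm, hx, map_zero]
  · exact sup_le (mul_comm a b ▸ actionKer_le_mul ρ b a) (actionKer_le_mul ρ a b)

theorem actionRange_mul {a b : 𝒜} (h : IsCoprime a b) :
    actionRange ρ (a * b) = actionRange ρ a ⊓ actionRange ρ b := by
  apply le_antisymm
  · exact le_inf (actionRange_mul_le ρ a b) (mul_comm a b ▸ actionRange_mul_le ρ b a)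
  · rintro x ⟨⟨y, hy⟩, ⟨z, hz⟩⟩
    obtain ⟨u, v, huv⟩ := exists_decomposition ρ h
    change ρ a y = x at hy
    change ρ b z = x at hz
    refine ⟨ρ u z + ρ v y, ?_⟩
    change ρ (a * b) _ = x
    conv_rhs => rw [huv x]
    rw [map_add]
    congr 1
    · rw [action_mul, action_comm ρ b, hz]
    · rw [mul_comm, action_mul, action_comm ρ a, hy]

theorem mem_actionRange_of_coprime {a b : 𝒜} (h : IsCoprime a b) {x : X}
    (hx : ρ b x ∈ actionRange ρ a) : x ∈ actionRange ρ a := by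
  obtain ⟨u, v, huv⟩ := exists_decomposition ρ h
  obtain ⟨y, hy⟩ := hx
  change ρ a y = _ at hy
  refine ⟨ρ u x + ρ v y, ?_⟩
  change ρ a _ = x
  conv_rhs => rw [huv x]
  rw [map_add, action_comm ρ b, ← hy, action_comm ρ v]

/-! ### Fredholm conditions on coprime products -/

theorem finiteDimensional_actionKer :
    CoprimeMultiplicative fun a => FiniteDimensional ℂ (actionKer ρ a) where
  one := by
    have : actionKer ρ 1 = ⊥ := by
      ext x; rw [mem_actionKer, action_one, Submodule.mem_bot]
    rw [this]; infer_instance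
  mul_iff {a b} h := by
    rw [actionKer_mul ρ h]
    refine ⟨fun _ => ⟨?_, ?_⟩, fun ⟨_, _⟩ => inferInstance⟩
    · exact Submodule.finiteDimensional_of_le (S₂ := actionKer ρ a ⊔ actionKer ρ b) le_sup_left
    · exact Submodule.finiteDimensional_of_le (S₂ := actionKer ρ a ⊔ actionKer ρ b) le_sup_right

theorem actionRange_one : actionRange ρ 1 = ⊤ := by
  ext x
  simpa using ⟨x, action_one ρ x⟩

theorem finiteDimensional_quotient_actionRange :
    CoprimeMultiplicative fun a => FiniteDimensional ℂ (X ⧸ actionRange ρ a) where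
  one := by
    rw [actionRange_one]; infer_instance
  mul_iff {a b} h := by
    rw [actionRange_mul ρ h]
    refine ⟨fun h => ⟨Submodule.CoFG.of_le inf_le_left h, Submodule.CoFG.of_le inf_le_right h⟩,
      fun ⟨h₁, h₂⟩ => Submodule.CoFG.inf h₁ h₂⟩

theorem isClosed_actionRange :
    CoprimeMultiplicative fun a => IsClosed (actionRange ρ a : Set X) where
  one := by
    rw [actionRange_one]; exact isClosed_univ
  mul_iff {a b} h := by
    have key : ∀ {a b : 𝒜}, IsCoprime a b → IsClosed (actionRange ρ (a * b) : Set X) →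
        IsClosed (actionRange ρ a : Set X) := by
      intro a b h hc
      -- The range of `a` is the preimage under `b` of the range of `a b`.
      convert hc.preimage (ρ b).continuous using 1
      ext x
      constructor
      · rintro ⟨y, rfl⟩
        exact ⟨y, by rw [mul_comm]; exact action_mul ρ b a y⟩
      · exact fun hx => mem_actionRange_of_coprime ρ h (actionRange_mul_le ρ a b hx)
    refine ⟨fun hc => ⟨key h hc, key h.symm (mul_comm a b ▸ hc)⟩, fun ⟨h₁, h₂⟩ => ?_⟩
    rw [actionRange_mul ρ h]
    exact h₁.inter h₂

/-! ### Ascent and descent on coprime products -/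

theorem actionKer_pow_stable {a : 𝒜} {n : ℕ} (h : actionKer ρ (a ^ n) = actionKer ρ (a ^ (n + 1)))
    {m : ℕ} (hm : n ≤ m) : actionKer ρ (a ^ m) = actionKer ρ (a ^ (m + 1)) := by
  obtain ⟨k, rfl⟩ := Nat.exists_eq_add_of_le hm
  ext x
  rw [mem_actionKer, mem_actionKer, add_right_comm, pow_add, pow_add, action_mul, action_mul,
    ← mem_actionKer, h, mem_actionKer]

theorem actionRange_pow_stable {a : 𝒜} {n : ℕ}
    (h : actionRange ρ (a ^ n) = actionRange ρ (a ^ (n + 1))) {m : ℕ} (hm : n ≤ m) :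
    actionRange ρ (a ^ m) = actionRange ρ (a ^ (m + 1)) := by
  obtain ⟨k, rfl⟩ := Nat.exists_eq_add_of_le' hm
  have key : ∀ j, actionRange ρ (a ^ (k + j)) =
      (actionRange ρ (a ^ j)).map (ρ (a ^ k) : X →ₗ[ℂ] X) := by
    intro j
    ext x
    simp only [Submodule.mem_map, mem_actionRange, pow_add, action_mul]
    constructor
    · rintro ⟨y, rfl⟩
      exact ⟨_, ⟨y, rfl⟩, rfl⟩
    · rintro ⟨_, ⟨y, rfl⟩, rfl⟩
      exact ⟨y, rfl⟩
  rw [add_assoc, key, key, h]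

theorem finite_ascent_coprimeMultiplicative :
    CoprimeMultiplicative fun a => ∃ n : ℕ, actionKer ρ (a ^ n) = actionKer ρ (a ^ (n + 1)) where
  one := ⟨0, by simp⟩
  mul_iff {a b} h := by
    have key : ∀ {a b : 𝒜}, IsCoprime a b → ∀ n : ℕ,
        actionKer ρ ((a * b) ^ n) = actionKer ρ ((a * b) ^ (n + 1)) →
        actionKer ρ (a ^ n) = actionKer ρ (a ^ (n + 1)) := by
      intro a b h n hn
      apply le_antisymm
      · rw [pow_succ']; exact actionKer_le_mul ρ _ _
      · intro x hx
        -- Both `a ^ (n + 1)` and `b ^ n` kill `a ^ n x`, the latter by stability for `a b`; being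
        -- coprime, they force `a ^ n x = 0`.
        obtain ⟨u, v, huv⟩ := exists_decomposition ρ (h.pow (m := n + 1) (n := n))
        have hx' : ρ (b ^ n) (ρ (a ^ n) x) = 0 := by
          rw [← action_mul, ← mul_pow, mul_comm b, ← mem_actionKer, hn, mul_pow, mul_comm]
          exact actionKer_le_mul ρ _ _ hx
        rw [mem_actionKer] at hx ⊢
        rw [huv (ρ (a ^ n) x), action_comm ρ (b ^ n), hx', map_zero, add_zero,
          action_comm ρ u, action_comm ρ (a ^ (n + 1)), action_comm ρ (a ^ (n + 1)), hx,
          map_zero, map_zero]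
    refine ⟨fun ⟨n, hn⟩ => ⟨⟨n, key h n hn⟩, ⟨n, key h.symm n (mul_comm a b ▸ hn)⟩⟩, ?_⟩
    rintro ⟨⟨n, hn⟩, ⟨m, hm⟩⟩
    refine ⟨max n m, ?_⟩
    rw [mul_pow, mul_pow, actionKer_mul ρ h.pow, actionKer_mul ρ h.pow,
      actionKer_pow_stable ρ hn (le_max_left n m), actionKer_pow_stable ρ hm (le_max_right n m)]

theorem finite_descent_coprimeMultiplicative :
    CoprimeMultiplicative fun a =>
      ∃ n : ℕ, actionRange ρ (a ^ n) = actionRange ρ (a ^ (n + 1)) where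
  one := ⟨0, by simp⟩
  mul_iff {a b} h := by
    have key : ∀ {a b : 𝒜}, IsCoprime a b → ∀ n : ℕ,
        actionRange ρ ((a * b) ^ n) = actionRange ρ ((a * b) ^ (n + 1)) →
        actionRange ρ (a ^ n) = actionRange ρ (a ^ (n + 1)) := by
      intro a b h n hn
      apply le_antisymm
      · rintro _ ⟨y, rfl⟩
        refine mem_actionRange_of_coprime ρ (h.pow (m := n + 1) (n := n)) ?_
        have : ρ (b ^ n) (ρ (a ^ n) y) ∈ actionRange ρ ((a * b) ^ (n + 1)) := by
          rw [← hn, ← action_mul, ← mul_pow, mul_comm b]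
          exact ⟨y, rfl⟩
        rw [mul_pow] at this
        exact actionRange_mul_le ρ _ _ this
      · rw [pow_succ]; exact actionRange_mul_le ρ _ _
    refine ⟨fun ⟨n, hn⟩ => ⟨⟨n, key h n hn⟩, ⟨n, key h.symm n (mul_comm a b ▸ hn)⟩⟩, ?_⟩
    rintro ⟨⟨n, hn⟩, ⟨m, hm⟩⟩
    refine ⟨max n m, ?_⟩
    rw [mul_pow, mul_pow, actionRange_mul ρ h.pow, actionRange_mul ρ h.pow,
      actionRange_pow_stable ρ hn (le_max_left n m), actionRange_pow_stable ρ hm (le_max_right n m)]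

/-! ### Operators whose graph is parametrized by a coprime pair -/

/-- The graph of `S` consists of the pairs `(ρ r w, ρ b w)`. -/
def HasParamGraph (S : X →ₗ.[ℂ] X) (r b : 𝒜) : Prop :=
  ∀ x y : X, (x, y) ∈ S.graph ↔ ∃ w, ρ r w = x ∧ ρ b w = y

/-- Bézout supplies the parameter `w = u x + v y`. The graph thus becomes the solution set of a
continuous equation, hence closed. -/
theorem exists_param_iff {r b : 𝒜} (h : IsCoprime r b) (x y : X) :
    (∃ w, ρ r w = x ∧ ρ b w = y) ↔ ρ b x = ρ r y := by
  constructor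
  · rintro ⟨w, rfl, rfl⟩
    exact action_comm ρ _ _ _
  · intro hxy
    obtain ⟨u, v, huv⟩ := exists_decomposition ρ h
    refine ⟨ρ u x + ρ v y, ?_, ?_⟩
    · conv_rhs => rw [huv x]
      rw [map_add, action_comm ρ r v, ← hxy, action_comm ρ v b, action_comm ρ b v]
    · conv_rhs => rw [huv y]
      rw [map_add, action_comm ρ b u, hxy, action_comm ρ u r]

variable {ρ} {S : X →ₗ.[ℂ] X} {r b : 𝒜}

theorem mem_nullSpace_iff {S : X →ₗ.[ℂ] X} {x : X} : x ∈ nullSpace S ↔ (x, 0) ∈ S.graph := by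
  rw [LinearPMap.mem_graph_iff]
  constructor
  · rintro ⟨y, hy, rfl⟩
    exact ⟨y, rfl, hy⟩
  · rintro ⟨y, hy, h⟩
    exact ⟨y, h, hy⟩

theorem mem_rangeSpace_iff {S : X →ₗ.[ℂ] X} {y : X} :
    y ∈ rangeSpace S ↔ ∃ x, (x, y) ∈ S.graph := by
  constructor
  · rintro ⟨x, rfl⟩
    exact ⟨x, S.mem_graph x⟩
  · rintro ⟨x, hx⟩
    obtain ⟨z, -, h⟩ := S.mem_graph_iff.1 hx
    exact ⟨z, h⟩

theorem mem_graph_mulOp {S S' : X →ₗ.[ℂ] X} {x y : X} :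
    (x, y) ∈ (mulOp S S').graph ↔ ∃ z, (x, z) ∈ S'.graph ∧ (z, y) ∈ S.graph := by
  constructor
  · intro h
    obtain ⟨⟨_, h₁, h₂⟩, rfl, rfl⟩ := (LinearPMap.mem_graph_iff _).1 h
    exact ⟨S' ⟨_, h₁⟩, S'.mem_graph ⟨_, h₁⟩, S.mem_graph ⟨_, h₂⟩⟩
  · rintro ⟨z, h, h'⟩
    obtain ⟨⟨x, hx⟩, rfl, rfl⟩ := S'.mem_graph_iff.1 h
    obtain ⟨⟨z, hz⟩, h₁, rfl⟩ := S.mem_graph_iff.1 h'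
    change z = S' ⟨x, hx⟩ at h₁
    subst h₁
    exact (mulOp S S').mem_graph ⟨x, hx, hz⟩

namespace HasParamGraph

theorem mem_graph_iff (hS : HasParamGraph ρ S r b) (h : IsCoprime r b) {x y : X} :
    (x, y) ∈ S.graph ↔ ρ b x = ρ r y := by
  rw [hS x y, exists_param_iff ρ h]

theorem isClosed (hS : HasParamGraph ρ S r b) (h : IsCoprime r b) : S.IsClosed := by
  have : (S.graph : Set (X × X)) = {p | ρ b p.1 = ρ r p.2} := by
    ext ⟨x, y⟩
    exact hS.mem_graph_iff h
  rw [LinearPMap.IsClosed, this]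
  exact isClosed_eq (by fun_prop) (by fun_prop)

theorem nullSpace_eq (hS : HasParamGraph ρ S r b) (h : IsCoprime r b) :
    nullSpace S = actionKer ρ b := by
  ext x
  rw [mem_nullSpace_iff, hS.mem_graph_iff h, map_zero, mem_actionKer]

theorem rangeSpace_eq (hS : HasParamGraph ρ S r b) : rangeSpace S = actionRange ρ b := by
  ext y
  simp [mem_rangeSpace_iff, hS _ y, mem_actionRange]

theorem powOp (hS : HasParamGraph ρ S r b) (h : IsCoprime r b) (n : ℕ) :
    HasParamGraph ρ (powOp S n) (r ^ n) (b ^ n) := by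
  induction n with
  | zero =>
    intro x y
    rw [pow_zero, pow_zero, LinearPMap.mem_graph_iff]
    simp only [action_one]
    constructor
    · rintro ⟨z, rfl, rfl⟩
      exact ⟨_, rfl, rfl⟩
    · rintro ⟨w, rfl, rfl⟩
      exact ⟨⟨w, trivial⟩, rfl, rfl⟩
  | succ n ih =>
    intro x y
    change (x, y) ∈ (mulOp S _).graph ↔ _
    rw [mem_graph_mulOp]
    constructor
    · rintro ⟨z, hz, hz'⟩
      obtain ⟨w, rfl, rfl⟩ := (ih _ _).1 hz
      obtain ⟨w', hw, rfl⟩ := (hS _ _).1 hz'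
      -- The two parameters satisfy `b ^ n w = r w'`, and `r`, `b ^ n` are coprime, so `w = r v` and
      -- `w' = b ^ n v` for a common `v`.
      obtain ⟨v, rfl, rfl⟩ := (exists_param_iff ρ (h.pow_right (n := n)) w w').2 hw.symm
      exact ⟨v, by rw [pow_succ, action_mul], by rw [pow_succ', action_mul]⟩
    · rintro ⟨w, rfl, rfl⟩
      refine ⟨ρ (b ^ n) (ρ r w), (ih _ _).2 ⟨ρ r w, by rw [pow_succ, action_mul], rfl⟩,
        (hS _ _).2 ⟨ρ (b ^ n) w, action_comm ρ _ _ _, by rw [pow_succ', action_mul]⟩⟩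

theorem isUpperSemiFredholm_iff (hS : HasParamGraph ρ S r b) (h : IsCoprime r b) :
    IsUpperSemiFredholm S ↔
      FiniteDimensional ℂ (actionKer ρ b) ∧ IsClosed (actionRange ρ b : Set X) := by
  rw [← hS.nullSpace_eq h, ← hS.rangeSpace_eq]
  exact ⟨fun h => ⟨h.2, h.3⟩, fun h' => ⟨hS.isClosed h, h'.1, h'.2⟩⟩

theorem isLowerSemiFredholm_iff (hS : HasParamGraph ρ S r b) (h : IsCoprime r b) :
    IsLowerSemiFredholm S ↔ FiniteDimensional ℂ (X ⧸ actionRange ρ b) := by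
  rw [← hS.rangeSpace_eq]
  exact ⟨fun h => h.2, fun h' => ⟨hS.isClosed h, h'⟩⟩

theorem ascent_lt_top_iff (hS : HasParamGraph ρ S r b) (h : IsCoprime r b) :
    ascent S < ⊤ ↔ ∃ n : ℕ, actionKer ρ (b ^ n) = actionKer ρ (b ^ (n + 1)) := by
  simp [ascent, iInf_lt_iff, (hS.powOp h _).nullSpace_eq h.pow]

theorem descent_lt_top_iff (hS : HasParamGraph ρ S r b) (h : IsCoprime r b) :
    descent S < ⊤ ↔ ∃ n : ℕ, actionRange ρ (b ^ n) = actionRange ρ (b ^ (n + 1)) := by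
  simp [descent, iInf_lt_iff, (hS.powOp h _).rangeSpace_eq]

end HasParamGraph

end Action

/-! ### The factorization in a commutative Banach algebra -/

section BanachAlgebra

open WeakDual

variable {𝒜 : Type*} [NormedCommRing 𝒜] [NormedAlgebra ℂ 𝒜]

/-- Solutions differ by integer multiples of `2πi / t`, and a disc contains finitely many such
translates. -/
theorem finite_setOf_exp_eq {t : ℝ} (ht : t ≠ 0) (μ : ℂ) (K : ℝ) :
    {z : ℂ | Complex.exp (t * z) = μ ∧ ‖z‖ ≤ K}.Finite := by
  rcases Set.eq_empty_or_nonempty {z : ℂ | Complex.exp (t * z) = μ ∧ ‖z‖ ≤ K} with h | ⟨z₀, h₀, -⟩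
  · rw [h]; exact Set.finite_empty
  have ht' : (t : ℂ) ≠ 0 := by exact_mod_cast ht
  set p : ℂ := 2 * Real.pi * Complex.I / t with hp_def
  have hp : 0 < ‖p‖ := norm_pos_iff.2 <|
    div_ne_zero Complex.two_pi_I_ne_zero ht'
  have hfin : {n : ℤ | |(n : ℝ)| ≤ (K + ‖z₀‖) / ‖p‖}.Finite := by
    refine (Set.finite_Icc (-⌈(K + ‖z₀‖) / ‖p‖⌉) ⌈(K + ‖z₀‖) / ‖p‖⌉).subset fun n hn => ?_
    have h := abs_le.1 (le_trans (show |(n : ℝ)| ≤ _ from hn) (Int.le_ceil _))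
    exact ⟨by exact_mod_cast h.1, by exact_mod_cast h.2⟩
  refine (hfin.image fun n : ℤ => z₀ + n * p).subset ?_
  rintro z ⟨hz, hzK⟩
  obtain ⟨n, hn⟩ := Complex.exp_eq_exp_iff_exists_int.1 (hz.trans h₀.symm)
  have hzn : z = z₀ + n * p := by
    rw [hp_def]; field_simp; linear_combination hn
  refine ⟨n, ?_, hzn.symm⟩
  rw [Set.mem_ofPred_eq, le_div_iff₀ hp]
  calc |(n : ℝ)| * ‖p‖ = ‖z - z₀‖ := by rw [hzn]; simp
    _ ≤ ‖z‖ + ‖z₀‖ := norm_sub_le _ _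
    _ ≤ _ := by gcongr

/-- Eliminating `R` between the two elements leaves the nonzero scalar `w - z`. -/
theorem isCoprime_one_add_mul (R : 𝒜) {z w : ℂ} (ν : ℂ) (h : z ≠ w) :
    IsCoprime (1 + algebraMap ℂ 𝒜 (z - ν) * R) (1 + algebraMap ℂ 𝒜 (w - ν) * R) := by
  have h' : algebraMap ℂ 𝒜 (w - z)⁻¹ * algebraMap ℂ 𝒜 (w - z) = 1 := by
    rw [← map_mul, inv_mul_cancel₀ (sub_ne_zero.2 h.symm), map_one]
  refine ⟨algebraMap ℂ 𝒜 (w - z)⁻¹ * algebraMap ℂ 𝒜 (w - ν),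
    -(algebraMap ℂ 𝒜 (w - z)⁻¹ * algebraMap ℂ 𝒜 (z - ν)), ?_⟩
  simp only [map_sub] at h' ⊢
  linear_combination h'

/-- The relations between `τ = T t`, the resolvent `R = (ν - A)⁻¹`, `D = A (T t)` and
`B z = ∫ s in 0..t, exp (z (t - s)) T s` that give the factorization of `μ - T t`. -/
structure IsFactorData (t : ℝ) (ν : ℂ) (τ R D : 𝒜) (B : ℂ → 𝒜) : Prop where
  continuous : Continuous B
  eq_mul : τ = R * (algebraMap ℂ 𝒜 ν * τ - D)
  sub_mul : ∀ z : ℂ, (algebraMap ℂ 𝒜 (Complex.exp (t * z)) - τ) * R =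
    (1 + algebraMap ℂ 𝒜 (z - ν) * R) * B z

namespace IsFactorData

variable {t : ℝ} {ν : ℂ} {τ R D : 𝒜} {B : ℂ → 𝒜}

/-! ### Characters evaluated on the factor data -/

theorem map_resolvent_ne_zero (h : IsFactorData t ν τ R D B) (χ : characterSpace ℂ 𝒜)
    (hτ : χ τ ≠ 0) : χ R ≠ 0 := by
  intro hR
  apply hτ
  rw [h.eq_mul, map_mul, hR, zero_mul]

theorem map_sub_mul (h : IsFactorData t ν τ R D B) (χ : characterSpace ℂ 𝒜) (z : ℂ) :
    (Complex.exp (t * z) - χ τ) * χ R = (1 + (z - ν) * χ R) * χ (B z) := by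
  simpa [AlgHomClass.commutes] using congrArg χ (h.sub_mul z)

theorem map_eq_exp (h : IsFactorData t ν τ R D B) (χ : characterSpace ℂ 𝒜) {z : ℂ}
    (hz : 1 + (z - ν) * χ R = 0) : χ τ = Complex.exp (t * z) := by
  have hR : χ R ≠ 0 := by
    rintro hR
    simp [hR] at hz
  have := h.map_sub_mul χ z
  rw [hz, zero_mul] at this
  exact (sub_eq_zero.1 ((mul_eq_zero.1 this).resolve_right hR)).symm

theorem map_deriv (h : IsFactorData t ν τ R D B) (χ : characterSpace ℂ 𝒜) {z : ℂ}
    (hz : 1 + (z - ν) * χ R = 0) : χ D = z * χ τ := by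
  have hR : χ R ≠ 0 := by
    rintro hR
    simp [hR] at hz
  have h₁ : χ τ = χ R * (ν * χ τ - χ D) := by
    simpa [AlgHomClass.commutes] using congrArg χ h.eq_mul
  apply mul_left_cancel₀ hR
  linear_combination h₁ - χ τ * hz

theorem exists_exp_eq (h : IsFactorData t ν τ R D B) (χ : characterSpace ℂ 𝒜)
    (hτ : χ τ ≠ 0) : ∃ z, 1 + (z - ν) * χ R = 0 ∧ χ τ = Complex.exp (t * z) := by
  -- Since `χ R ≠ 0`, the equation for `z` is solved by `ν - (χ R)⁻¹`.
  have hz : 1 + ((ν - (χ R)⁻¹) - ν) * χ R = 0 := by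
    have := h.map_resolvent_ne_zero χ hτ
    field_simp
    ring
  exact ⟨_, hz, h.map_eq_exp χ hz⟩

/-- The simple zero of `exp (t z) - τ` at `z`, seen by a character. -/
theorem map_conv (h : IsFactorData t ν τ R D B) (χ : characterSpace ℂ 𝒜) {z : ℂ}
    (hz : 1 + (z - ν) * χ R = 0) : χ (B z) = t * Complex.exp (t * z) := by
  have hR : χ R ≠ 0 := by
    rintro hR
    simp [hR] at hz
  have hd : HasDerivAt (fun w : ℂ => Complex.exp (t * w)) (t * Complex.exp (t * z)) z := by
    have := ((hasDerivAt_id z).const_mul (t : ℂ)).cexp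
    simpa [mul_comm] using this
  have h₁ := hasDerivAt_iff_tendsto_slope.1 hd
  have h₂ : Tendsto (fun w => χ (B w)) (𝓝[≠] z) (𝓝 (χ (B z))) :=
    (((map_continuous χ).comp h.continuous).tendsto z).mono_left nhdsWithin_le_nhds
  refine tendsto_nhds_unique (h₂.congr' ?_) h₁
  -- For `w ≠ z` the character turns `sub_mul` into a formula for the slope of the exponential: it
  -- equals `χ (B w)`.
  filter_upwards [self_mem_nhdsWithin] with w hw
  have hw : w - z ≠ 0 := sub_ne_zero.2 hw
  have h₃ := h.map_sub_mul χ w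
  rw [h.map_eq_exp χ hz] at h₃
  rw [slope_def_field, eq_div_iff hw]
  apply mul_right_cancel₀ hR
  linear_combination (-1 : ℂ) * h₃ - χ (B w) * hz

/-- A character killing the factor sends `D` to `z exp (t z)`, too large for a spectral value of
`D`. When `exp (t z)` is fixed this leaves only a bounded set of `z`. -/
theorem isUnit_of_lt [CompleteSpace 𝒜] (h : IsFactorData t ν τ R D B) {z : ℂ}
    (hz : ‖D‖ * ‖(1 : 𝒜)‖ < ‖z * Complex.exp (t * z)‖) :
    IsUnit (1 + algebraMap ℂ 𝒜 (z - ν) * R) := by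
  by_contra hu
  obtain ⟨χ, hχ⟩ := CharacterSpace.exists_apply_eq_zero hu
  have hχ' : 1 + (z - ν) * χ R = 0 := by
    simpa [AlgHomClass.commutes] using hχ
  have h₁ := h.map_deriv χ hχ'
  rw [h.map_eq_exp χ hχ'] at h₁
  rw [← h₁] at hz
  exact hz.not_ge (spectrum.norm_le_norm_mul_of_mem (AlgHom.apply_mem_spectrum χ D))

/-- Multiply `sub_mul` by `ν - z` and use that `(ν - z) R` is `1` minus the factor. -/
theorem eq_mul_factor (h : IsFactorData t ν τ R D B) {μ z : ℂ} (hz : Complex.exp (t * z) = μ) :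
    algebraMap ℂ 𝒜 μ - τ = (1 + algebraMap ℂ 𝒜 (z - ν) * R) *
      (algebraMap ℂ 𝒜 (ν - z) * B z + (algebraMap ℂ 𝒜 μ - τ)) := by
  have := h.sub_mul z
  rw [hz] at this
  simp only [map_sub] at this ⊢
  linear_combination (algebraMap ℂ 𝒜 z - algebraMap ℂ 𝒜 ν) * (-1 : 𝒜) * this

/-- With `∑ u z ∏_{w ≠ z} b w = 1` and `μ - τ = b z * C z`, the cofactor is `H = ∑ u z C z`. A
character killing `H` kills `μ - τ`, hence exactly one `b z`; then every `C w` with `w ≠ z`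
vanishes, `u z` does not, and `C z` takes the value `(ν - z) t μ ≠ 0`, a contradiction. -/
theorem exists_isUnit [CompleteSpace 𝒜] (h : IsFactorData t ν τ R D B) (ht : t ≠ 0) {μ : ℂ}
    (hμ : μ ≠ 0) (F : Finset ℂ) (hF : ∀ z ∈ F, Complex.exp (t * z) = μ)
    (hF' : ∀ z ∉ F, Complex.exp (t * z) = μ → IsUnit (1 + algebraMap ℂ 𝒜 (z - ν) * R)) :
    ∃ H : 𝒜, IsUnit H ∧
      algebraMap ℂ 𝒜 μ - τ = (∏ z ∈ F, (1 + algebraMap ℂ 𝒜 (z - ν) * R)) * H := by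
  classical
  set b : ℂ → 𝒜 := fun z => 1 + algebraMap ℂ 𝒜 (z - ν) * R with hb
  set C : ℂ → 𝒜 := fun z => algebraMap ℂ 𝒜 (ν - z) * B z + (algebraMap ℂ 𝒜 μ - τ) with hC
  have hχb : ∀ (χ : characterSpace ℂ 𝒜) z, χ (b z) = 1 + (z - ν) * χ R := fun χ z => by
    simp [hb, AlgHomClass.commutes]
  have hbC : ∀ z ∈ F, algebraMap ℂ 𝒜 μ - τ = b z * C z := fun z hz => h.eq_mul_factor (hF z hz)
  -- the zero of `χ` is one of the points of `F`
  have hzero : ∀ χ : characterSpace ℂ 𝒜, χ (algebraMap ℂ 𝒜 μ - τ) = 0 →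
      ∃ z ∈ F, χ (b z) = 0 := by
    intro χ hχ
    have hτ : χ τ = μ := by
      rw [_root_.map_sub, AlgHomClass.commutes, sub_eq_zero] at hχ
      exact hχ.symm
    obtain ⟨z, hz, hτz⟩ := h.exists_exp_eq χ (hτ ▸ hμ)
    refine ⟨z, ?_, by rw [hχb, hz]⟩
    by_contra hzF
    have := (hF' z hzF (hτz.symm.trans hτ)).map χ
    rw [show χ (1 + algebraMap ℂ 𝒜 (z - ν) * R) = 0 from (hχb χ z).trans hz] at this
    exact not_isUnit_zero this
  rcases F.eq_empty_or_nonempty with rfl | hne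
  · refine ⟨algebraMap ℂ 𝒜 μ - τ, ?_, by simp⟩
    by_contra hu
    obtain ⟨χ, hχ⟩ := CharacterSpace.exists_apply_eq_zero hu
    obtain ⟨z, hz, -⟩ := hzero χ hχ
    simp at hz
  obtain ⟨u, hu⟩ := (exists_sum_eq_one_iff_pairwise_coprime (t := F) (s := b) hne).2
    fun z w hzw => isCoprime_one_add_mul R ν fun h => hzw (Subtype.ext h)
  have hfac : algebraMap ℂ 𝒜 μ - τ = (∏ z ∈ F, b z) * ∑ z ∈ F, u z * C z := by
    rw [Finset.mul_sum, ← mul_one (algebraMap ℂ 𝒜 μ - τ), ← hu, Finset.mul_sum]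
    refine Finset.sum_congr rfl fun z hz => ?_
    rw [hbC z hz, Finset.sdiff_singleton_eq_erase, ← Finset.mul_prod_erase F b hz]
    ring
  refine ⟨_, ?_, hfac⟩
  by_contra hnu
  obtain ⟨χ, hχ⟩ := CharacterSpace.exists_apply_eq_zero hnu
  obtain ⟨z, hz, hbz⟩ := hzero χ (by rw [hfac, map_mul, hχ, mul_zero])
  have hz0 := hbz
  rw [hχb] at hz0
  have hother : ∀ w ∈ F, w ≠ z → χ (C w) = 0 := by
    intro w hw hwz
    have h₁ : χ (b w) * χ (C w) = 0 := by
      rw [← map_mul, ← hbC w hw, hbC z hz, map_mul, hbz, zero_mul]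
    refine (mul_eq_zero.1 h₁).resolve_left fun h₂ => hwz ?_
    rw [hχb] at h₂
    have hR : χ R ≠ 0 := by
      rintro hR
      simp [hR] at hz0
    apply mul_right_cancel₀ hR
    linear_combination h₂ - hz0
  have huz : χ (u z) ≠ 0 := by
    intro huz
    have h₁ := congrArg χ hu
    rw [map_sum, map_one] at h₁
    refine zero_ne_one ((Finset.sum_eq_zero fun w hw => ?_).symm.trans h₁)
    rcases eq_or_ne w z with rfl | hwz
    · rw [map_mul, huz, zero_mul]
    · rw [map_mul, map_prod, Finset.prod_eq_zero (i := z) (by simp [hz, hwz.symm]) hbz, mul_zero]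
  rw [map_sum, Finset.sum_eq_single_of_mem z hz fun w hw hwz => by
    rw [map_mul, hother w hw hwz, mul_zero], map_mul] at hχ
  have hCz := (mul_eq_zero.1 hχ).resolve_left huz
  have hτ : χ (algebraMap ℂ 𝒜 μ - τ) = 0 := by rw [hbC z hz, map_mul, hbz, zero_mul]
  rw [hC, map_add, hτ, add_zero, map_mul, AlgHomClass.commutes, h.map_conv χ hz0, hF z hz] at hCz
  have hνz : ν - z ≠ 0 := by
    intro hνz
    rw [show z - ν = 0 by linear_combination -hνz] at hz0
    simp at hz0
  have ht' : (t : ℂ) ≠ 0 := by exact_mod_cast ht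
  exact mul_ne_zero hνz (mul_ne_zero ht' hμ) hCz

theorem iff_forall_exp_eq [CompleteSpace 𝒜] (h : IsFactorData t ν τ R D B) (ht : t ≠ 0) {μ : ℂ}
    (hμ : μ ≠ 0) {P : 𝒜 → Prop} (hP : CoprimeMultiplicative P) :
    P (algebraMap ℂ 𝒜 μ - τ) ↔
      ∀ z, Complex.exp (t * z) = μ → P (1 + algebraMap ℂ 𝒜 (z - ν) * R) := by
  have hfin := finite_setOf_exp_eq ht μ (‖D‖ * ‖(1 : 𝒜)‖ / ‖μ‖)
  have hF : ∀ z, z ∈ hfin.toFinset ↔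
      Complex.exp (t * z) = μ ∧ ‖z‖ ≤ ‖D‖ * ‖(1 : 𝒜)‖ / ‖μ‖ := fun z => by simp
  have hunit : ∀ z ∉ hfin.toFinset, Complex.exp (t * z) = μ →
      IsUnit (1 + algebraMap ℂ 𝒜 (z - ν) * R) := by
    intro z hz hzμ
    rw [hF, not_and, not_le] at hz
    apply h.isUnit_of_lt
    rw [hzμ, norm_mul, ← div_lt_iff₀ (norm_pos_iff.2 hμ)]
    exact hz hzμ
  obtain ⟨H, hH, hfac⟩ := h.exists_isUnit ht hμ hfin.toFinset (fun z hz => ((hF z).1 hz).1) hunit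
  rw [hfac, hP.mul_isUnit_iff hH,
    hP.prod_iff fun z _ w _ hzw => isCoprime_one_add_mul R ν hzw]
  refine ⟨fun hz z hzμ => ?_, fun hz z hzF => hz z ((hF z).1 hzF).1⟩
  by_cases hzF : z ∈ hfin.toFinset
  · exact hz z hzF
  · exact hP.of_isUnit (hunit z hzF hzμ)

end IsFactorData

end BanachAlgebra

/-! ### Semigroups -/

section Semigroup

variable {X : Type*} [NormedAddCommGroup X] [NormedSpace ℂ X] {T : ℝ → X →L[ℂ] X}

theorem IsC0Semigroup.commute (hT : IsC0Semigroup T) {s t : ℝ} (hs : 0 ≤ s) (ht : 0 ≤ t) :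
    T s * T t = T t * T s := by
  change (T s).comp (T t) = (T t).comp (T s)
  rw [← hT.add s t hs ht, add_comm, hT.add t s ht hs]

/-- Clamping time by `max s 0` gives a function continuous on the whole line, whatever `T` is at
negative times. -/
theorem continuous_orbit (hT : IsC0Semigroup T) (hd : IsDifferentiableSemigroup T) (x : X) :
    Continuous fun s : ℝ => T (max s 0) x := by
  have h : ContinuousOn (fun s => T s x) (Set.Ici 0) := by
    intro s hs
    rcases (show (0 : ℝ) ≤ s from hs).eq_or_lt with rfl | hs
    · rw [← continuousWithinAt_Ioi_iff_Ici, ContinuousWithinAt, hT.zero]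
      exact hT.tendsto x
    · exact (hd x s hs).continuousAt.continuousWithinAt
  exact h.comp_continuous (by fun_prop) fun s => le_max_right s 0

theorem continuous_weighted_orbit (hT : IsC0Semigroup T) (hd : IsDifferentiableSemigroup T) (z : ℂ)
    (x : X) : Continuous fun s : ℝ => Complex.exp (-(s * z)) • T (max s 0) x :=
  (by fun_prop : Continuous fun s : ℝ => Complex.exp (-(s * z))).smul (continuous_orbit hT hd x)

theorem exists_bound_semigroup [CompleteSpace X] (hT : IsC0Semigroup T)
    (hd : IsDifferentiableSemigroup T) (t : ℝ) : ∃ M, ∀ s ∈ Set.Icc 0 t, ‖T (max s 0)‖ ≤ M := by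
  obtain ⟨M, hM⟩ := banach_steinhaus (g := fun s : Set.Icc (0 : ℝ) t => T (max (s : ℝ) 0))
    fun x => by
      obtain ⟨C, hC⟩ := isCompact_Icc.exists_bound_of_continuousOn (s := Set.Icc 0 t)
        (continuous_orbit hT hd x).continuousOn
      exact ⟨C, fun s => hC s s.2⟩
  exact ⟨M, fun s hs => hM ⟨s, hs⟩⟩

theorem IsGenValue.map {x y : X} (h : IsGenValue T x y) {C : X →L[ℂ] X}
    (hC : ∀ s, 0 ≤ s → T s * C = C * T s) : IsGenValue T (C x) (C y) := by
  refine ((C.continuous.tendsto y).comp h).congr' ?_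
  filter_upwards [self_mem_nhdsWithin] with s hs
  have : T s (C x) = C (T s x) := congrArg (fun S : X →L[ℂ] X => S x) (hC s (le_of_lt hs))
  simp [this]

theorem IsGenValue.of_hasDerivAt {f : ℝ → X} {x y : X} (hf : HasDerivAt f y 0)
    (h : ∀ s, 0 ≤ s → f s = T s x) (hx : f 0 = x) : IsGenValue T x y := by
  have h₁ := (hasDerivAt_iff_tendsto_slope_zero.1 hf).mono_left
    (nhdsWithin_mono (0 : ℝ) (fun s (hs : 0 < s) => hs.ne' : Set.Ioi (0 : ℝ) ⊆ {0}ᶜ))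
  refine h₁.congr' ?_
  filter_upwards [self_mem_nhdsWithin] with s hs
  rw [zero_add, hx, h s (le_of_lt hs), ← Complex.ofReal_inv, Complex.coe_smul]

theorem mem_graph_generator {x y : X} : (x, y) ∈ (generator T).graph ↔ IsGenValue T x y := by
  constructor
  · intro h
    obtain ⟨z, rfl, rfl⟩ := (LinearPMap.mem_graph_iff _).1 h
    exact z.2.choose_spec
  · intro h
    have hx : x ∈ (generator T).domain := ⟨y, h⟩
    have : generator T ⟨x, hx⟩ = y := hx.choose_spec.unique h
    rw [← this]
    exact (generator T).mem_graph ⟨x, hx⟩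

theorem mem_graph_shift {S : X →ₗ.[ℂ] X} {z : ℂ} {x y : X} :
    (x, y) ∈ (shift S z).graph ↔ (x, y + z • x) ∈ S.graph := by
  rw [LinearPMap.mem_graph_iff, LinearPMap.mem_graph_iff]
  constructor
  · rintro ⟨w, rfl, rfl⟩
    refine ⟨w, rfl, ?_⟩
    change S w = -(z • (w : X)) + S w + z • (w : X)
    abel
  · rintro ⟨w, rfl, h⟩
    refine ⟨w, rfl, ?_⟩
    change -(z • (w : X)) + S w = y
    change S w = y + z • (w : X) at h
    rw [h]
    abel

theorem mem_graph_ofBounded {S : X →L[ℂ] X} {x y : X} :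
    (x, y) ∈ (ofBounded S).graph ↔ S x = y := by
  rw [LinearPMap.mem_graph_iff]
  constructor
  · rintro ⟨w, rfl, rfl⟩
    rfl
  · rintro rfl
    exact ⟨⟨x, trivial⟩, rfl, rfl⟩

/-! ### The bounded operators built from the semigroup -/

/-- `A (T t)` is a bounded operator. -/
theorem exists_deriv_semigroup [CompleteSpace X] (hT : IsC0Semigroup T)
    (hd : IsDifferentiableSemigroup T) {t : ℝ} (ht : 0 < t) :
    ∃ D : X →L[ℂ] X, ∀ x, IsGenValue T (T t x) (D x) := by
  set y : X → X := fun x => deriv (fun s => T s x) t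
  have hy : ∀ x, HasDerivAt (fun s => T s x) (y x) t := fun x => (hd x t ht).hasDerivAt
  -- Along the steps `1 / (n + 1)` the derivative is a pointwise limit of bounded operators, so it
  -- is linear and bounded by Banach–Steinhaus.
  have hlim : ∀ x, Tendsto (fun n : ℕ => (((n : ℂ) + 1) • (T (t + 1 / ((n : ℝ) + 1)) - T t)) x)
      atTop (𝓝 (y x)) := by
    intro x
    have h₁ := (hasDerivAt_iff_tendsto_slope_zero.1 (hy x))
    have h₂ : Tendsto (fun n : ℕ => 1 / ((n : ℝ) + 1)) atTop (𝓝[≠] 0) :=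
      tendsto_nhdsWithin_iff.2 ⟨tendsto_one_div_add_atTop_nhds_zero_nat,
        Eventually.of_forall fun n => by
          have : (n : ℝ) + 1 ≠ 0 := by positivity
          simpa using this⟩
    refine (h₁.comp h₂).congr fun n => ?_
    have : ((n : ℂ) + 1) = (((n : ℝ) + 1 : ℝ) : ℂ) := by push_cast; rfl
    simp only [Function.comp, one_div, inv_inv, this, Complex.coe_smul]
    rfl
  refine ⟨continuousLinearMapOfTendsto _ (tendsto_pi_nhds.2 hlim), fun x => ?_⟩
  change IsGenValue T (T t x) (y x)
  have h₀ : HasDerivAt (fun s => T s x) (y x) (0 + t) := by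
    rw [zero_add]; exact hy x
  refine IsGenValue.of_hasDerivAt (h₀.comp_add_const 0 t) (fun s hs => ?_) (by rw [zero_add])
  rw [hT.add s t hs ht.le]
  rfl

/-- The operators `B z = ∫ s in 0..t, exp (z (t - s)) T s`. -/
theorem exists_convolution [CompleteSpace X] (hT : IsC0Semigroup T)
    (hd : IsDifferentiableSemigroup T) {t : ℝ} (ht : 0 < t) :
    ∃ B : ℂ → X →L[ℂ] X, Continuous B ∧ ∀ z x, B z x =
      Complex.exp (t * z) • ∫ s in (0 : ℝ)..t, Complex.exp (-(s * z)) • T (max s 0) x := by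
  obtain ⟨M, hM⟩ := exists_bound_semigroup hT hd t
  have hM0 : 0 ≤ M := (norm_nonneg _).trans (hM 0 ⟨le_rfl, ht.le⟩)
  have hc : ∀ (z : ℂ) x, Continuous fun s : ℝ => Complex.exp (-(s * z)) • T (max s 0) x :=
    continuous_weighted_orbit hT hd
  have hint : ∀ (z : ℂ) x, IntervalIntegrable
      (fun s : ℝ => Complex.exp (-(s * z)) • T (max s 0) x) MeasureTheory.volume 0 t :=
    fun z x => (hc z x).intervalIntegrable _ _
  have hIoc : ∀ s ∈ Set.uIoc 0 t, s ∈ Set.Icc 0 t := fun s hs => by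
    rw [Set.uIoc_of_le ht.le] at hs
    exact ⟨hs.1.le, hs.2⟩
  have hexp : ∀ (z : ℂ), ∀ s ∈ Set.Icc 0 t, ‖Complex.exp (-(s * z))‖ ≤ Real.exp (t * ‖z‖) := by
    intro z s hs
    refine (Complex.norm_exp_le_exp_norm _).trans (Real.exp_le_exp.2 ?_)
    rw [norm_neg, norm_mul, Complex.norm_real, Real.norm_of_nonneg hs.1]
    gcongr
    exact hs.2
  have hT' : ∀ s ∈ Set.Icc 0 t, ∀ x, ‖T (max s 0) x‖ ≤ M * ‖x‖ := fun s hs x =>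
    (T _).le_of_opNorm_le (hM s hs) x
  have hbd : ∀ (z : ℂ) x, ‖∫ s in (0 : ℝ)..t, Complex.exp (-(s * z)) • T (max s 0) x‖ ≤
      Real.exp (t * ‖z‖) * M * t * ‖x‖ := by
    intro z x
    have := intervalIntegral.norm_integral_le_of_norm_le_const (a := 0) (b := t)
      (f := fun s : ℝ => Complex.exp (-(s * z)) • T (max s 0) x)
      (C := Real.exp (t * ‖z‖) * (M * ‖x‖)) fun s hs => by
        rw [norm_smul]
        exact mul_le_mul (hexp z s (hIoc s hs)) (hT' s (hIoc s hs) x) (norm_nonneg _)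
          (Real.exp_nonneg _)
    rw [sub_zero, abs_of_pos ht] at this
    linarith
  let B₀ : ℂ → X →L[ℂ] X := fun z => LinearMap.mkContinuous
    { toFun := fun x => ∫ s in (0 : ℝ)..t, Complex.exp (-(s * z)) • T (max s 0) x
      map_add' := fun x y => by
        simp only [map_add, smul_add]
        exact intervalIntegral.integral_add (hint z x) (hint z y)
      map_smul' := fun c x => by
        simp only [map_smul, RingHom.id_apply]
        rw [← intervalIntegral.integral_smul]
        simp only [smul_comm c] } (Real.exp (t * ‖z‖) * M * t) (hbd z)
  have hB₀ : ∀ z x, B₀ z x = ∫ s in (0 : ℝ)..t, Complex.exp (-(s * z)) • T (max s 0) x :=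
    fun _ _ => rfl
  have hcont : Continuous B₀ := by
    rw [continuous_iff_continuousAt]
    intro z
    rw [ContinuousAt, tendsto_iff_norm_sub_tendsto_zero]
    have hlim : Tendsto (fun w : ℂ => Real.exp (t * ‖z‖) * (2 * (t * ‖w - z‖)) * M * t)
        (𝓝 z) (𝓝 0) := by
      have : Continuous fun w : ℂ => Real.exp (t * ‖z‖) * (2 * (t * ‖w - z‖)) * M * t := by
        fun_prop
      simpa using this.tendsto z
    -- The estimate `‖exp a - 1‖ ≤ 2 ‖a‖` requires `‖a‖ ≤ 1`.
    have hsmall : ∀ᶠ w in 𝓝 z, t * ‖w - z‖ < 1 := by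
      have : Continuous fun w : ℂ => t * ‖w - z‖ := by fun_prop
      exact this.continuousAt.eventually_lt_const (by simp)
    refine tendsto_of_tendsto_of_tendsto_of_le_of_le' tendsto_const_nhds hlim
      (Eventually.of_forall fun _ => norm_nonneg _) ?_
    filter_upwards [hsmall] with w hw
    refine ContinuousLinearMap.opNorm_le_bound _ (by positivity) fun x => ?_
    rw [_root_.sub_apply, hB₀, hB₀,
      ← intervalIntegral.integral_sub (hint w x) (hint z x)]
    have := intervalIntegral.norm_integral_le_of_norm_le_const (a := 0) (b := t)
      (f := fun s : ℝ => Complex.exp (-(s * w)) • T (max s 0) x -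
        Complex.exp (-(s * z)) • T (max s 0) x)
      (C := Real.exp (t * ‖z‖) * (2 * (t * ‖w - z‖)) * (M * ‖x‖)) fun s hs => by
        have hs := hIoc s hs
        rw [← sub_smul, norm_smul]
        refine mul_le_mul ?_ (hT' s hs x) (norm_nonneg _) (by positivity)
        have hle : ‖-((s : ℂ) * (w - z))‖ ≤ t * ‖w - z‖ := by
          rw [norm_neg, norm_mul, Complex.norm_real, Real.norm_of_nonneg hs.1]
          gcongr
          exact hs.2
        have heq : Complex.exp (-(s * w)) - Complex.exp (-(s * z)) =
            Complex.exp (-(s * z)) * (Complex.exp (-(s * (w - z))) - 1) := by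
          rw [mul_sub, ← Complex.exp_add, mul_one]
          ring_nf
        rw [heq, norm_mul]
        refine mul_le_mul (hexp z s hs) ?_ (norm_nonneg _) (Real.exp_nonneg _)
        exact (Complex.norm_exp_sub_one_le (hle.trans hw.le)).trans (by gcongr)
    rw [sub_zero, abs_of_pos ht] at this
    linarith
  refine ⟨fun z => Complex.exp (t * z) • B₀ z, by fun_prop, fun z x => by
    rw [_root_.smul_apply, hB₀]⟩

theorem commute_convolution [CompleteSpace X] (hT : IsC0Semigroup T)
    (hd : IsDifferentiableSemigroup T) {t : ℝ} {B : X →L[ℂ] X} {z : ℂ}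
    (hB : ∀ x, B x =
      Complex.exp (t * z) • ∫ s in (0 : ℝ)..t, Complex.exp (-(s * z)) • T (max s 0) x)
    {C : X →L[ℂ] X} (hC : ∀ s, 0 ≤ s → T s * C = C * T s) : C * B = B * C := by
  ext x
  change C (B x) = B (C x)
  have hc : Continuous fun s : ℝ => Complex.exp (-(s * z)) • T (max s 0) x :=
    continuous_weighted_orbit hT hd z x
  rw [hB, hB, map_smul, ← ContinuousLinearMap.intervalIntegral_comp_comm _
    (hc.intervalIntegrable _ _)]
  congr 2
  ext s
  rw [map_smul]
  congr 1
  exact congrArg (fun S : X →L[ℂ] X => S x) (hC _ (le_max_right s 0)).symm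

/-- With `F` the primitive of the weighted orbit, a change of variable gives `T h (B x) = exp ((h +
t) z) (F (h + t) - F h)` for `h ≥ 0`; the value of `A` on `B x` is the derivative of the right side
at `h = 0`. -/
theorem isGenValue_convolution [CompleteSpace X] (hT : IsC0Semigroup T)
    (hd : IsDifferentiableSemigroup T) {t : ℝ} (ht : 0 < t) {B : X →L[ℂ] X} {z : ℂ}
    (hB : ∀ x, B x =
      Complex.exp (t * z) • ∫ s in (0 : ℝ)..t, Complex.exp (-(s * z)) • T (max s 0) x) (x : X) :
    IsGenValue T (B x) (z • B x - (Complex.exp (t * z) • x - T t x)) := by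
  have hc : Continuous fun s : ℝ => Complex.exp (-(s * z)) • T (max s 0) x :=
    continuous_weighted_orbit hT hd z x
  set f : ℝ → X := fun s => Complex.exp (-(s * z)) • T (max s 0) x with hf
  set F : ℝ → X := fun u => ∫ s in (0 : ℝ)..u, f s with hF
  have hF' : ∀ u, HasDerivAt F (f u) u := fun u =>
    intervalIntegral.integral_hasDerivAt_right (hc.intervalIntegrable _ _)
      hc.stronglyMeasurable.stronglyMeasurableAtFilter hc.continuousAt
  have hBF : B x = Complex.exp (t * z) • F t := hB x
  have hF0 : F 0 = 0 := intervalIntegral.integral_same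
  have hderiv : HasDerivAt (fun h : ℝ => Complex.exp ((h + t : ℝ) * z) • (F (h + t) - F h))
      (z • B x - (Complex.exp (t * z) • x - T t x)) 0 := by
    have h₁ : HasDerivAt (fun h : ℝ => F (h + t)) (f (0 + t)) 0 := (hF' _).comp_add_const 0 t
    have h₂ : HasDerivAt (fun h : ℝ => Complex.exp ((h + t : ℝ) * z))
        (Complex.exp ((0 + t : ℝ) * z) * (1 * z)) 0 := by
      have : HasDerivAt (fun h : ℝ => ((h + t : ℝ) : ℂ)) 1 0 := by
        simpa using ((hasDerivAt_id (0 : ℝ)).add_const t).ofReal_comp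
      exact (this.mul_const z).cexp
    refine (h₂.smul (h₁.sub (hF' 0))).congr_deriv ?_
    simp only [Pi.sub_apply, hf, zero_add, hF0, sub_zero, max_self, max_eq_left ht.le, hT.zero, hBF, one_mul,
      smul_sub, smul_smul, Complex.ofReal_zero, zero_mul, neg_zero, Complex.exp_zero, one_smul,
      ContinuousLinearMap.id_apply]
    rw [← Complex.exp_add, add_neg_cancel, Complex.exp_zero, one_smul, mul_comm z]
    abel
  refine IsGenValue.of_hasDerivAt hderiv (fun h hh => ?_) ?_
  · rw [hBF, map_smul, hF]
    simp only
    rw [intervalIntegral.integral_interval_sub_left (hc.intervalIntegrable _ _)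
      (hc.intervalIntegrable _ _), ← ContinuousLinearMap.intervalIntegral_comp_comm _
      (hc.intervalIntegrable _ _)]
    have h₁ : ∫ s in h..(h + t), f s = ∫ s in (0 : ℝ)..t, f (s + h) := by
      rw [intervalIntegral.integral_comp_add_right, zero_add, add_comm t h]
    have h₂ : ∀ s ∈ Set.uIcc 0 t, T h (f s) = Complex.exp (h * z) • f (s + h) := by
      intro s hs
      rw [Set.uIcc_of_le ht.le] at hs
      simp only [hf, map_smul, smul_smul]
      rw [max_eq_left hs.1, max_eq_left (add_nonneg hs.1 hh), ← Complex.exp_add, add_comm s h,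
        hT.add h s hh hs.1, ContinuousLinearMap.comp_apply]
      congr 2
      push_cast
      ring
    rw [intervalIntegral.integral_congr h₂, intervalIntegral.integral_smul, h₁, smul_smul,
      ← Complex.exp_add]
    congr 2
    push_cast
    ring
  · rw [zero_add, hF0, sub_zero, hBF]

end Semigroup

/-! ### The spectral mapping theorem -/

section Mapping

universe u

variable {X : Type u} [NormedAddCommGroup X] [NormedSpace ℂ X] {T : ℝ → X →L[ℂ] X}

/-- The bicommutant of the semigroup. -/
abbrev bicommutant (T : ℝ → X →L[ℂ] X) : Subalgebra ℂ (X →L[ℂ] X) :=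
  Subalgebra.centralizer ℂ (Set.centralizer (T '' Set.Ici 0))

theorem mem_bicommutant {S : X →L[ℂ] X} : S ∈ bicommutant T ↔
    ∀ C : X →L[ℂ] X, (∀ s, 0 ≤ s → T s * C = C * T s) → C * S = S * C := by
  rw [Subalgebra.mem_centralizer_iff]
  refine forall_congr' fun C => imp_congr_left ?_
  rw [Set.mem_centralizer_iff, Set.forall_mem_image]
  rfl

theorem IsC0Semigroup.bicommutant_comm (hT : IsC0Semigroup T) (a b : bicommutant T) :
    a * b = b * a :=
  Subtype.ext <| Set.centralizer_centralizer_comm_of_comm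
    (by rintro _ ⟨s, hs, rfl⟩ _ ⟨r, hr, rfl⟩; exact hT.commute hs hr) _ a.2 _ b.2

/-- The bicommutant is a commutative Banach algebra. -/
noncomputable abbrev bicommutantRing (hT : IsC0Semigroup T) : NormedCommRing (bicommutant T) where
  __ := (inferInstance : NormedRing (bicommutant T))
  mul_comm := hT.bicommutant_comm

theorem completeSpace_bicommutant [CompleteSpace X] : CompleteSpace (bicommutant T) :=
  (Set.isClosed_centralizer (Set.centralizer (T '' Set.Ici 0))).completeSpace_coe

/-- If `V = exp (t ν) - T t` is invertible, then `(ν - A) B ν = V` makes `B ν V⁻¹` a right inverse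
of `ν - A`. It commutes with the semigroup, hence with `A`, so it is a left inverse too. -/
theorem exists_resolvent [CompleteSpace X] (hT : IsC0Semigroup T) {t : ℝ} (ht : 0 < t)
    {B : ℂ → X →L[ℂ] X}
    (hB : ∀ z, B z ∈ bicommutant T)
    (hBG : ∀ z x, IsGenValue T (B z x) (z • B z x - (Complex.exp (t * z) • x - T t x))) :
    ∃ (ν : ℂ) (R : X →L[ℂ] X), R ∈ bicommutant T ∧
      (∀ x, IsGenValue T (R x) (ν • R x - x)) ∧
      ∀ x y, IsGenValue T x y → R (ν • x - y) = x := by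
  -- `ν` is chosen so that `exp (t ν) = c` lies beyond the spectrum of `T t`; the added `1` makes
  -- the inequality strict and `c` positive.
  set c : ℝ := ‖T t‖ * ‖(1 : X →L[ℂ] X)‖ + 1 with hc
  have hc0 : 0 < c := by positivity
  set ν : ℂ := ((Real.log c / t : ℝ) : ℂ) with hν
  have hexp : Complex.exp (t * ν) = c := by
    rw [hν, ← Complex.ofReal_mul, ← Complex.ofReal_exp, mul_div_cancel₀ _ ht.ne',
      Real.exp_log hc0]
  have hunit : IsUnit (algebraMap ℂ (X →L[ℂ] X) (Complex.exp (t * ν)) - T t) := by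
    refine spectrum.mem_resolventSet_of_norm_lt_mul ?_
    rw [hexp, Complex.norm_real, Real.norm_of_nonneg hc0.le, hc]
    exact lt_add_one _
  obtain ⟨V, hV⟩ := hunit
  have hVx : ∀ x, (V : X →L[ℂ] X) x = Complex.exp (t * ν) • x - T t x := fun x => by
    rw [hV]; rfl
  have hVinv : ∀ x, (V : X →L[ℂ] X) ((↑V⁻¹ : X →L[ℂ] X) x) = x := fun x =>
    congrArg (fun S : X →L[ℂ] X => S x) V.mul_inv
  have hVmem : (V : X →L[ℂ] X) ∈ bicommutant T := by
    rw [hV]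
    refine sub_mem (Subalgebra.algebraMap_mem _ _) (mem_bicommutant.2 fun C hC => ?_)
    exact (hC t ht.le).symm
  have hVinvmem : (↑V⁻¹ : X →L[ℂ] X) ∈ bicommutant T :=
    mem_bicommutant.2 fun C hC =>
      (Commute.units_inv_right (show Commute C V from mem_bicommutant.1 hVmem C hC)).eq
  have hR : B ν * (↑V⁻¹ : X →L[ℂ] X) ∈ bicommutant T := mul_mem (hB ν) hVinvmem
  have hRG : ∀ x, IsGenValue T ((B ν * (↑V⁻¹ : X →L[ℂ] X)) x)
      (ν • (B ν * (↑V⁻¹ : X →L[ℂ] X)) x - x) := by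
    intro x
    have := hBG ν ((↑V⁻¹ : X →L[ℂ] X) x)
    rwa [← hVx, hVinv] at this
  refine ⟨ν, _, hR, hRG, fun x y h => ?_⟩
  have hcomm : ∀ s, 0 ≤ s → T s * (B ν * (↑V⁻¹ : X →L[ℂ] X)) =
      (B ν * (↑V⁻¹ : X →L[ℂ] X)) * T s := fun s hs =>
    mem_bicommutant.1 hR _ fun r hr => hT.commute hr hs
  have := (h.map hcomm).unique (hRG x)
  rw [map_sub, map_smul, this, sub_sub_cancel]

/-- The bicommutant serves because it is commutative, complete and closed under inverses, and
everything built canonically from the semigroup lies in it. -/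
theorem exists_factorData [CompleteSpace X] (hT : IsC0Semigroup T) (hd : IsDifferentiableSemigroup T)
    {t : ℝ} (ht : 0 < t) :
    ∃ (𝒜 : Type u) (_ : NormedCommRing 𝒜) (_ : NormedAlgebra ℂ 𝒜) (_ : CompleteSpace 𝒜)
      (ρ : 𝒜 →ₐ[ℂ] (X →L[ℂ] X)) (ν : ℂ) (τ R D : 𝒜) (B : ℂ → 𝒜),
      IsFactorData t ν τ R D B ∧ ρ τ = T t ∧ (∀ x, IsGenValue T (ρ R x) (ν • ρ R x - x)) ∧
        ∀ x y, IsGenValue T x y → ρ R (ν • x - y) = x := by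
  obtain ⟨D, hD⟩ := exists_deriv_semigroup hT hd ht
  obtain ⟨B, hBc, hB⟩ := exists_convolution hT hd ht
  have hBmem : ∀ z, B z ∈ bicommutant T := fun z =>
    mem_bicommutant.2 fun C hC => commute_convolution hT hd (hB z) hC
  have hBG := fun z => isGenValue_convolution hT hd ht (hB z)
  have hDmem : D ∈ bicommutant T := mem_bicommutant.2 fun C hC => by
    ext x
    have h₁ := (hD x).map hC
    rw [show C (T t x) = T t (C x) from
      congrArg (fun S : X →L[ℂ] X => S x) (hC t ht.le).symm] at h₁
    exact h₁.unique (hD (C x))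
  have hτmem : T t ∈ bicommutant T := mem_bicommutant.2 fun C hC => (hC t ht.le).symm
  obtain ⟨ν, R, hRmem, hRG, hR⟩ := exists_resolvent hT ht hBmem hBG
  let _ := bicommutantRing hT
  refine ⟨bicommutant T, inferInstance, { (bicommutant T).toNormedAlgebra with },
    completeSpace_bicommutant, { (bicommutant T).val with }, ν, ⟨T t, hτmem⟩, ⟨R, hRmem⟩,
    ⟨D, hDmem⟩, fun z => ⟨B z, hBmem z⟩, ⟨?_, ?_, fun z => ?_⟩, rfl, hRG, hR⟩
  · exact hBc.subtype_mk hBmem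
  · apply Subtype.ext
    change T t = R * (algebraMap ℂ _ ν * T t - D)
    ext x
    exact (hR _ _ (hD x)).symm
  · rw [mul_comm]
    apply Subtype.ext
    change R * (algebraMap ℂ _ (Complex.exp (t * z)) - T t) =
      (1 + algebraMap ℂ _ (z - ν) * R) * B z
    ext x
    change R (Complex.exp (t * z) • x - T t x) = B z x + (z - ν) • R (B z x)
    -- The identity `sub_mul` is `R (ν - A) = 1` applied to `B z x`.
    have h := hR _ _ (hBG z x)
    rw [show ν • B z x - (z • B z x - (Complex.exp (t * z) • x - T t x)) =
      (ν - z) • B z x + (Complex.exp (t * z) • x - T t x) by module, map_add, map_smul] at h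
    rw [eq_sub_of_add_eq' h]
    module

/-- A property of operators that, for operators whose graph is parametrized by a coprime pair
`(r, b)`, is a property of `b` alone which is multiplicative on coprime pairs. -/
def IsSpectralProperty (Φ : (X →ₗ.[ℂ] X) → Prop) : Prop :=
  ∀ (𝒜 : Type u) [CommRing 𝒜] (ρ : 𝒜 →+* (X →L[ℂ] X)), ∃ P : 𝒜 → Prop,
    CoprimeMultiplicative P ∧
      ∀ S r b, HasParamGraph ρ S r b → IsCoprime r b → (Φ S ↔ P b)

theorem IsSpectralProperty.and {Φ Ψ : (X →ₗ.[ℂ] X) → Prop} (hΦ : IsSpectralProperty Φ)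
    (hΨ : IsSpectralProperty Ψ) : IsSpectralProperty fun S => Φ S ∧ Ψ S := by
  intro 𝒜 _ ρ
  obtain ⟨P, hP, hPS⟩ := hΦ 𝒜 ρ
  obtain ⟨Q, hQ, hQS⟩ := hΨ 𝒜 ρ
  exact ⟨_, hP.and hQ, fun S r b h h' => and_congr (hPS S r b h h') (hQS S r b h h')⟩

theorem isSpectralProperty_isUpperSemiFredholm :
    IsSpectralProperty (IsUpperSemiFredholm (X := X)) := fun _ _ ρ =>
  ⟨_, (finiteDimensional_actionKer ρ).and (isClosed_actionRange ρ),
    fun _ _ _ hS h => hS.isUpperSemiFredholm_iff h⟩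

theorem isSpectralProperty_isLowerSemiFredholm :
    IsSpectralProperty (IsLowerSemiFredholm (X := X)) := fun _ _ ρ =>
  ⟨_, finiteDimensional_quotient_actionRange ρ, fun _ _ _ hS h => hS.isLowerSemiFredholm_iff h⟩

theorem isSpectralProperty_ascent_lt_top :
    IsSpectralProperty fun S : X →ₗ.[ℂ] X => ascent S < ⊤ := fun _ _ ρ =>
  ⟨_, finite_ascent_coprimeMultiplicative ρ, fun _ _ _ hS h => hS.ascent_lt_top_iff h⟩

theorem isSpectralProperty_descent_lt_top :
    IsSpectralProperty fun S : X →ₗ.[ℂ] X => descent S < ⊤ := fun _ _ ρ =>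
  ⟨_, finite_descent_coprimeMultiplicative ρ, fun _ _ _ hS h => hS.descent_lt_top_iff h⟩

theorem IsSpectralProperty.spectral_mapping [CompleteSpace X] {Φ : (X →ₗ.[ℂ] X) → Prop}
    (hΦ : IsSpectralProperty Φ) (hT : IsC0Semigroup T) (hd : IsDifferentiableSemigroup T)
    {t : ℝ} (ht : 0 < t) :
    {z | ¬ Φ (shift (ofBounded (T t)) z)} \ {0} =
      (fun z : ℂ => Complex.exp (t * z)) '' {z | ¬ Φ (shift (generator T) z)} := by
  obtain ⟨𝒜, _, _, _, ρ, ν, τ, R, D, B, h, hτ, hRG, hR⟩ := exists_factorData hT hd ht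
  obtain ⟨P, hP, hPS⟩ := hΦ 𝒜 (ρ : 𝒜 →+* (X →L[ℂ] X))
  have hbounded : ∀ μ, Φ (shift (ofBounded (T t)) μ) ↔ P (algebraMap ℂ 𝒜 μ - τ) := by
    intro μ
    -- Writing `x = -w` turns the value of `T t - μ` at `x` into `(μ - τ) w`, the sign used in the
    -- factorization.
    refine hPS _ (-1) _ (fun x y => ?_) isCoprime_one_left.neg_left
    have h₁ : ∀ w, ρ (-1) w = -w := fun w => by rw [map_neg, map_one]; rfl
    have h₂ : ∀ w, ρ (algebraMap ℂ 𝒜 μ - τ) w = μ • w - T t w := fun w => by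
      rw [map_sub, AlgHom.commutes, hτ]; rfl
    change _ ↔ ∃ w, ρ (-1) w = x ∧ ρ (algebraMap ℂ 𝒜 μ - τ) w = y
    simp only [mem_graph_shift, mem_graph_ofBounded, h₁, h₂]
    constructor
    · intro hxy
      exact ⟨-x, neg_neg x, by rw [map_neg, hxy, smul_neg]; abel⟩
    · rintro ⟨w, rfl, rfl⟩
      rw [map_neg, smul_neg]; abel
  have hgen : ∀ z, Φ (shift (generator T) z) ↔ P (1 + algebraMap ℂ 𝒜 (z - ν) * R) := by
    intro z
    -- `(A - z) (-R w) = w + (z - ν) R w`, and `-R` ranges over the whole domain of `A`.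
    refine hPS _ (-R) _ (fun x y => ?_) ⟨algebraMap ℂ 𝒜 (z - ν), 1, by ring⟩
    have h₁ : ∀ w, ρ (-R) w = -ρ R w := fun w => by rw [map_neg]; rfl
    have h₂ : ∀ w, ρ (1 + algebraMap ℂ 𝒜 (z - ν) * R) w = w + (z - ν) • ρ R w := fun w => by
      rw [map_add, map_mul, map_one, AlgHom.commutes]; rfl
    change _ ↔ ∃ w, ρ (-R) w = x ∧ ρ (1 + algebraMap ℂ 𝒜 (z - ν) * R) w = y
    simp only [mem_graph_shift, mem_graph_generator, h₁, h₂]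
    constructor
    · intro hxy
      have hRx := hR _ _ hxy
      refine ⟨-(ν • x - (y + z • x)), by rw [map_neg, neg_neg, hRx], ?_⟩
      rw [map_neg, hRx]
      module
    · rintro ⟨w, rfl, rfl⟩
      convert hRG (-w) using 1
      · rw [map_neg]
      · rw [map_neg]
        module
  ext μ
  simp only [Set.mem_sdiff, Set.mem_singleton_iff, Set.mem_image]
  change ¬ Φ (shift (ofBounded (T t)) μ) ∧ μ ≠ 0 ↔
    ∃ z, ¬ Φ (shift (generator T) z) ∧ Complex.exp (t * z) = μ
  simp only [hbounded, hgen]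
  constructor
  · rintro ⟨hμP, hμ⟩
    rw [h.iff_forall_exp_eq ht.ne' hμ hP] at hμP
    push Not at hμP
    obtain ⟨z, hz, hzP⟩ := hμP
    exact ⟨z, hzP, hz⟩
  · rintro ⟨z, hzP, rfl⟩
    refine ⟨fun hμP => hzP ?_, Complex.exp_ne_zero _⟩
    exact (h.iff_forall_exp_eq ht.ne' (Complex.exp_ne_zero _) hP).1 hμP z rfl

end Mapping

end SpectralMapping

theorem mainTheorem3 {X : Type*} [NormedAddCommGroup X] [NormedSpace ℂ X] [CompleteSpace X]
    (T : ℝ → X →L[ℂ] X) (hT : SpectralMapping.IsC0Semigroup T)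
    (hd : SpectralMapping.IsDifferentiableSemigroup T) (t : ℝ) (ht : 0 < t) :
    SpectralMapping.specUF (SpectralMapping.ofBounded (T t)) \ {0} =
        (fun z : ℂ => Complex.exp (t * z)) ''
          SpectralMapping.specUF (SpectralMapping.generator T) ∧
      SpectralMapping.specLF (SpectralMapping.ofBounded (T t)) \ {0} =
        (fun z : ℂ => Complex.exp (t * z)) ''
          SpectralMapping.specLF (SpectralMapping.generator T) ∧
      SpectralMapping.specF (SpectralMapping.ofBounded (T t)) \ {0} =
        (fun z : ℂ => Complex.exp (t * z)) ''
          SpectralMapping.specF (SpectralMapping.generator T) ∧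
      SpectralMapping.specUB (SpectralMapping.ofBounded (T t)) \ {0} =
        (fun z : ℂ => Complex.exp (t * z)) ''
          SpectralMapping.specUB (SpectralMapping.generator T) ∧
      SpectralMapping.specLB (SpectralMapping.ofBounded (T t)) \ {0} =
        (fun z : ℂ => Complex.exp (t * z)) ''
          SpectralMapping.specLB (SpectralMapping.generator T) ∧
      SpectralMapping.specB (SpectralMapping.ofBounded (T t)) \ {0} =
        (fun z : ℂ => Complex.exp (t * z)) ''
          SpectralMapping.specB (SpectralMapping.generator T) := by
  open SpectralMapping in
  have huf := isSpectralProperty_isUpperSemiFredholm (X := X)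
  have hlf := isSpectralProperty_isLowerSemiFredholm (X := X)
  have hub := huf.and isSpectralProperty_ascent_lt_top
  have hlb := hlf.and isSpectralProperty_descent_lt_top
  exact ⟨huf.spectral_mapping hT hd ht, hlf.spectral_mapping hT hd ht,
    (huf.and hlf).spectral_mapping hT hd ht, hub.spectral_mapping hT hd ht,
    hlb.spectral_mapping hT hd ht, (hub.and hlb).spectral_mapping hT hd ht⟩
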